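/- Let $k\ge 2$ be an integer, $\mathbb{N}=\{0,1,2,\dots\}$ and $\Sigma_k=\{0,1,\dots,k-1\}$. For a word $x=c_1\cdots c_t\in\Sigma_k^*$ let $[x]_k=\sum_{i=1}^t c_i k^{t-i}$. A set $S\subseteq\mathbb{N}$ is called $(\mathbb{N},k)$-automatic if $S=\{[x]_k : x\in K\}$ for some regular language $K\subseteq\Sigma_k^*$. For a word $w=[c_1,d_1]\cdots[c_t,d_t]$ over the alphabet $\Sigma_k^2=\Sigma_k\times\Sigma_k$ let $\pi_1(w)=c_1\cdots c_t$ and $\pi_2(w)=d_1\cdots d_t$, and, if $[\pi_2(w)]_k\ne 0$, let $\mathrm{quo}_k(w)=[\pi_1(w)]_k/[\pi_2(w)]_k$. For $p,q\in\mathbb{N}$ let $(p,q)_k$ be the unique word $w\in(\Sigma_k^2)^*$ that does not begin with the letter $[0,0]$ and satisfies $[\pi_1(w)]_k=p$ and $[\pi_2(w)]_k=q$. Let $L\subseteq(\Sigma_k^2)^*$ be a regular language such that no word of $L$ begins or ends with the letter $[0,0]$, and such that for every $w\in L$ we have $[\pi_2(w)]_k\neq 0$ and $\mathrm{quo}_k(w)\in\mathbb{N}$.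 Then there are integers $A,B\ge 0$, non-negative integers $a_1,\dots,a_A,b_1,\dots,b_B$ and $(\mathbb{N},k)$-automatic sets $S_1,\dots,S_A,T_1,\dots,T_B\subseteq\mathbb{N}$ such that $$L=\bigcup_{1\le i\le A}\{(m a_i,m)_k : m\in S_i\}\ \cup\bigcup_{1\le j\le B}\{(b_j n,b_j)_k : n\in T_j\}.$$ Moreover, such a decomposition can be computed: there is an algorithm that, given $k$ and a deterministic finite automaton accepting a language $L$ as above, halts and outputs integers $a_1,\dots,a_A$, $b_1,\dots,b_B$ and deterministic finite automata over $\Sigma_k$ whose accepted languages represent (through $x\mapsto[x]_k$) sets $S_1,\dots,S_A,T_1,\dots,T_B$ with this property. -/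

import Mathlib

namespace AutomaticRationals

/-- `[x]_k`: the integer represented in base `k` by the word `x` over `Σ_k = {0, …, k-1}`,
most significant digit first. -/
def value {k : ℕ} (x : List (Fin k)) : ℕ :=
  Nat.ofDigits k (x.reverse.map Fin.val)

/-- `[L]_k`. -/
def valueSet {k : ℕ} (L : Language (Fin k)) : Set ℕ :=
  {n | ∃ x ∈ L, value x = n}

/-- `(ℕ, k)`-automatic sets. -/
def IsNatAutomatic (k : ℕ) (S : Set ℕ) : Prop :=
  ∃ L : Language (Fin k), L.IsRegular ∧ S = valueSet L

/-- The numerator `[π₁(w)]_k`. -/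
def num {k : ℕ} (w : List (Fin k × Fin k)) : ℕ := value (w.map Prod.fst)

/-- The denominator `[π₂(w)]_k`. -/
def den {k : ℕ} (w : List (Fin k × Fin k)) : ℕ := value (w.map Prod.snd)

/-- `quo_k(w)`; meaningful only if `den w ≠ 0`. -/
def quo {k : ℕ} (w : List (Fin k × Fin k)) : ℚ := (num w : ℚ) / (den w : ℚ)

/-- The set `quo_k(L)` is defined. -/
def QuoDefined {k : ℕ} (L : Language (Fin k × Fin k)) : Prop :=
  ∀ w ∈ L, den w ≠ 0

/-- `quo_k(L)`; meaningful only if `QuoDefined L`. -/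
def quoSet {k : ℕ} (L : Language (Fin k × Fin k)) : Set ℚ :=
  {r | ∃ w ∈ L, quo w = r}

/-- The letter `[0,0]`. -/
def IsZeroPair {k : ℕ} (p : Fin k × Fin k) : Prop := (p.1 : ℕ) = 0 ∧ (p.2 : ℕ) = 0

def NoLeadingZeroPair {k : ℕ} (w : List (Fin k × Fin k)) : Prop :=
  ∀ p, w.head? = some p → ¬ IsZeroPair p

def NoTrailingZeroPair {k : ℕ} (w : List (Fin k × Fin k)) : Prop :=
  ∀ p, w.getLast? = some p → ¬ IsZeroPair p

/-- `w` is the canonical representation `(p, q)_k` of the pair `(p, q)`: the one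
without leading `[0,0]`. -/
def IsCanonical {k : ℕ} (w : List (Fin k × Fin k)) (p q : ℕ) : Prop :=
  NoLeadingZeroPair w ∧ num w = p ∧ den w = q

/-- The words of `L` have no leading or trailing `[0,0]`, the set `quo_k(L)` is defined, and
it consists of natural numbers. -/
def Admissible {k : ℕ} (L : Language (Fin k × Fin k)) : Prop :=
  (∀ w ∈ L, NoLeadingZeroPair w ∧ NoTrailingZeroPair w) ∧
    QuoDefined L ∧ quoSet L ⊆ Set.range (fun n : ℕ => (n : ℚ))

/-- `{(m a, m)_k : m ∈ S}`. -/
def fixedQuotient (k a : ℕ) (S : Set ℕ) : Set (List (Fin k × Fin k)) :=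
  {w | ∃ m ∈ S, IsCanonical w (m * a) m}

/-- `{(b n, b)_k : n ∈ T}`. -/
def fixedDenominator (k b : ℕ) (T : Set ℕ) : Set (List (Fin k × Fin k)) :=
  {w | ∃ n ∈ T, IsCanonical w (b * n) b}

/-- `L` is the union of the `{(m a_i, m)_k : m ∈ S_i}` and the `{(b_j n, b_j)_k : n ∈ T_j}`,
where the `S_i` and the `T_j` are `(ℕ, k)`-automatic. -/
def IsDecomposition {k : ℕ} (L : Language (Fin k × Fin k)) {A B : ℕ}
    (a : Fin A → ℕ) (S : Fin A → Set ℕ) (b : Fin B → ℕ) (T : Fin B → Set ℕ) : Prop :=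
  (∀ i, IsNatAutomatic k (S i)) ∧ (∀ j, IsNatAutomatic k (T j)) ∧
    {w | w ∈ L} = (⋃ i, fixedQuotient k (a i) (S i)) ∪ (⋃ j, fixedDenominator k (b j) (T j))

/-- Finite descriptions of automata, as data on which algorithms operate: `(N, t, F)` describes
the automaton with states `0, …, N`, initial state `0`, transition table `t` and list `F` of
accepting states. -/
abbrev AutCode : Type := ℕ × List ℕ × List ℕ

/-- The automaton that `c` describes over an alphabet of `m` letters numbered by `e`: in state
`q`, on the letter number `i`, it moves to the state in entry `q * m + i` of the table (reduced
modulo the number of states; a missing entry counts as `0`). -/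
def AutCode.toDFA {α : Type} {m : ℕ} (e : α ≃ Fin m) (c : AutCode) : DFA α (Fin (c.1 + 1)) where
  step q x := Fin.ofNat (c.1 + 1) (c.2.1.getD (q.val * m + (e x).val) 0)
  start := 0
  accept := {q | q.val ∈ c.2.2}

/-- The language over `Σ_k` accepted by the automaton `c`. -/
def AutCode.lang (k : ℕ) (c : AutCode) : Language (Fin k) :=
  (AutCode.toDFA (Equiv.refl (Fin k)) c).accepts

/-- The language over `Σ_k²` accepted by the automaton `c`; the letter `[x, y]` has the number
`y + k * x`. -/
def AutCode.pairLang (k : ℕ) (c : AutCode) : Language (Fin k × Fin k) :=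
  (AutCode.toDFA finProdFinEquiv c).accepts

/-- A finite description of a decomposition: the list of the `(a_i, automaton for S_i)` and the
list of the `(b_j, automaton for T_j)`. -/
abbrev DecompCode : Type := List (ℕ × AutCode) × List (ℕ × AutCode)

/-- The decomposition that `d` describes is one of `L`. -/
def DecompCode.Describes {k : ℕ} (d : DecompCode) (L : Language (Fin k × Fin k)) : Prop :=
  IsDecomposition L
    (fun i : Fin d.1.length => (d.1.get i).1)
    (fun i => valueSet (AutCode.lang k (d.1.get i).2))
    (fun j : Fin d.2.length => (d.2.get j).1)
    (fun j => valueSet (AutCode.lang k (d.2.get j).2))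

end AutomaticRationals

/-! Let N be the number of states, and split a word of the language as `z ++ v`, where `v` begins at
the first nonzero denominator digit. Suppose that `z` and `v` both have length at least N, so that
each contains a block that can be pumped. Pumping a block `s` of `v` gives numerators and
denominators proportional to P K^m + Q and P' K^m + Q', with K = k^|s|, and divisibility for all m
forces P Q' = P' Q. Inserting a block of `z` changes P, because the first letter has a nonzero
numerator digit, but not P', Q, Q'. Hence Q' = 0, and then Q = 0. In both tracks this equates the
finite fraction with the digits `t` that follow `s` and the periodic fraction with period `s`; being
less than 1 and having coprime denominators, they vanish. Then the word ends in [0,0], a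
contradiction. So `z` is short and the quotient is at most k^N, or `v` is short and the denominator
is below k^N (`Admissible.length_lt_or`, `Admissible.num_le_or_den_lt`).

Thus finitely many quotients a and denominators b suffice. For each of them an automaton reads m or
n, guesses the word of the language, and stores its state together with two carries, which stay in a
bounded range (`exists_carry`, `mem_carryCode_lang`). The subset construction makes it
deterministic, and since every search in it is bounded, the whole decomposition is primitive
recursive (`primrec_decomp`). -/

namespace AutomaticRationals

/-! ### Values of words and uniqueness of canonical representations -/

section Value

variable {k : ℕ}

@[simp]
theorem value_nil : value ([] : List (Fin k)) = 0 := by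
  simp [value]

theorem value_append (x y : List (Fin k)) :
    value (x ++ y) = value x * k ^ y.length + value y := by
  simp only [value, List.reverse_append, List.map_append, Nat.ofDigits_append, List.length_map,
    List.length_reverse]
  ring

theorem value_singleton (d : Fin k) : value [d] = d := by
  simp [value]

theorem value_concat (x : List (Fin k)) (d : Fin k) : value (x ++ [d]) = value x * k + d := by
  simp [value_append, value_singleton]

theorem value_cons (d : Fin k) (x : List (Fin k)) :
    value (d :: x) = d * k ^ x.length + value x := by
  rw [← List.singleton_append, value_append, value_singleton]

theorem value_lt (hk : 2 ≤ k) (x : List (Fin k)) : value x < k ^ x.length := by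
  have := Nat.ofDigits_lt_base_pow_length (b := k) (l := x.reverse.map Fin.val) hk (by simp)
  simpa [value] using this

theorem value_inj_of_length_eq (hk : 2 ≤ k) {x y : List (Fin k)} (hl : x.length = y.length)
    (h : value x = value y) : x = y := by
  have := Nat.ofDigits_inj_of_len_eq (b := k) (L1 := x.reverse.map Fin.val)
    (L2 := y.reverse.map Fin.val) hk (by simp [hl]) (by simp) (by simp) h
  exact List.reverse_injective (List.map_injective_iff.2 Fin.val_injective this)

theorem exists_value_eq (n l : ℕ) (h : n < k ^ l) :
    ∃ x : List (Fin k), x.length = l ∧ value x = n := by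
  induction l generalizing n with
  | zero => exact ⟨[], rfl, by simp at h; simp [h]⟩
  | succ l ih =>
    have hk : 0 < k := by
      rcases Nat.eq_zero_or_pos k with rfl | hk
      · simp at h
      · exact hk
    obtain ⟨x, hx, hv⟩ := ih (n / k) (Nat.div_lt_of_lt_mul (by rwa [pow_succ'] at h))
    refine ⟨x ++ [⟨n % k, Nat.mod_lt _ hk⟩], by simp [hx], ?_⟩
    rw [value_concat, hv]
    exact Nat.div_add_mod' n k

theorem num_append (u v : List (Fin k × Fin k)) :
    num (u ++ v) = num u * k ^ v.length + num v := by
  simp [num, value_append]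

theorem den_append (u v : List (Fin k × Fin k)) :
    den (u ++ v) = den u * k ^ v.length + den v := by
  simp [den, value_append]

theorem num_concat (u : List (Fin k × Fin k)) (p : Fin k × Fin k) :
    num (u ++ [p]) = num u * k + p.1 := by
  simp [num, value_concat]

theorem den_concat (u : List (Fin k × Fin k)) (p : Fin k × Fin k) :
    den (u ++ [p]) = den u * k + p.2 := by
  simp [den, value_concat]

theorem num_cons (p : Fin k × Fin k) (u : List (Fin k × Fin k)) :
    num (p :: u) = p.1 * k ^ u.length + num u := by
  simp [num, value_cons]

theorem den_cons (p : Fin k × Fin k) (u : List (Fin k × Fin k)) :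
    den (p :: u) = p.2 * k ^ u.length + den u := by
  simp [den, value_cons]

@[simp]
theorem num_nil : num ([] : List (Fin k × Fin k)) = 0 := by
  simp [num]

@[simp]
theorem den_nil : den ([] : List (Fin k × Fin k)) = 0 := by
  simp [den]

theorem num_lt (hk : 2 ≤ k) (w : List (Fin k × Fin k)) : num w < k ^ w.length := by
  simpa [num] using value_lt hk (w.map Prod.fst)

theorem den_lt (hk : 2 ≤ k) (w : List (Fin k × Fin k)) : den w < k ^ w.length := by
  simpa [den] using value_lt hk (w.map Prod.snd)

theorem den_eq_zero {w : List (Fin k × Fin k)} (h : ∀ p ∈ w, (p.2 : ℕ) = 0) : den w = 0 := by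
  induction w with
  | nil => simp
  | cons p w ih => simp_all [den_cons]

theorem eq_zero_of_num_den_eq_zero (hk : 2 ≤ k) {w : List (Fin k × Fin k)} (hn : num w = 0)
    (hd : den w = 0) : ∀ p ∈ w, IsZeroPair p := by
  have hk0 : k ≠ 0 := by omega
  induction w with
  | nil => simp
  | cons p w ih =>
    simp only [num_cons, den_cons, Nat.add_eq_zero_iff, mul_eq_zero, pow_eq_zero_iff', hk0,
      false_and, or_false] at hn hd
    exact List.forall_mem_cons.2 ⟨⟨hn.1, hd.1⟩, ih hn.2 hd.2⟩

/-- A word without leading `[0,0]` is at most as long as any word for the same pair. -/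
theorem length_le_of_noLeadingZeroPair (hk : 2 ≤ k) {u v : List (Fin k × Fin k)}
    (hu : NoLeadingZeroPair u) (hn : num u = num v) (hd : den u = den v) :
    u.length ≤ v.length := by
  cases u with
  | nil => simp
  | cons p u =>
    by_contra! hlt
    have hpow : k ^ v.length ≤ k ^ u.length :=
      Nat.pow_le_pow_right (by omega) (by simp at hlt; omega)
    have h1 := num_lt hk v
    have h2 := den_lt hk v
    rw [← hn, num_cons] at h1
    rw [← hd, den_cons] at h2
    refine hu p rfl ⟨?_, ?_⟩
    · by_contra h0
      have := Nat.le_mul_of_pos_left (k ^ u.length) (Nat.pos_of_ne_zero h0)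
      omega
    · by_contra h0
      have := Nat.le_mul_of_pos_left (k ^ u.length) (Nat.pos_of_ne_zero h0)
      omega

/-- Each word is at most as long as the other, and digits of a fixed length are determined by their
value. -/
theorem eq_of_noLeadingZeroPair (hk : 2 ≤ k) {u v : List (Fin k × Fin k)}
    (hu : NoLeadingZeroPair u) (hv : NoLeadingZeroPair v) (hn : num u = num v)
    (hd : den u = den v) : u = v := by
  have hl : u.length = v.length :=
    le_antisymm (length_le_of_noLeadingZeroPair hk hu hn hd)
      (length_le_of_noLeadingZeroPair hk hv hn.symm hd.symm)
  have h1 : u.map Prod.fst = v.map Prod.fst := value_inj_of_length_eq hk (by simpa) hn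
  have h2 : u.map Prod.snd = v.map Prod.snd := value_inj_of_length_eq hk (by simpa) hd
  rw [← List.zip_unzip u, ← List.zip_unzip v, List.unzip_eq_map, List.unzip_eq_map, h1, h2]

theorem Admissible.den_dvd_num {L : Language (Fin k × Fin k)} (hL : Admissible L)
    {w : List (Fin k × Fin k)} (hw : w ∈ L) : den w ∣ num w := by
  obtain ⟨n, hn⟩ := hL.2.2 ⟨w, hw, rfl⟩
  have hd : (den w : ℚ) ≠ 0 := by exact_mod_cast hL.2.1 w hw
  simp only [quo, eq_div_iff hd] at hn
  exact ⟨n, by rw [mul_comm]; exact_mod_cast hn.symm⟩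

end Value

/-! ### Pumping: bounded quotient or bounded denominator -/

section Pumping

/-- The word `x ^ n`. -/
def wordPow {α : Type*} (x : List α) (n : ℕ) : List α := (List.replicate n x).flatten

@[simp]
theorem wordPow_zero {α : Type*} (x : List α) : wordPow x 0 = [] := rfl

theorem wordPow_succ {α : Type*} (x : List α) (n : ℕ) :
    wordPow x (n + 1) = x ++ wordPow x n := by
  simp [wordPow, List.replicate_succ]

theorem evalFrom_wordPow {α σ : Type*} (M : DFA α σ) {q : σ} {x : List α}
    (h : M.evalFrom q x = q) (n : ℕ) : M.evalFrom q (wordPow x n) = q := by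
  induction n with
  | zero => rfl
  | succ n ih => rw [wordPow_succ, DFA.evalFrom_of_append, h, ih]

variable {k : ℕ}

/-- A closed form of the value of `u x^n y`, cleared of the denominator `k^|x| - 1`. -/
theorem value_pump (u x y : List (Fin k)) (n : ℕ) :
    ((k : ℤ) ^ x.length - 1) * value (u ++ wordPow x n ++ y) =
      k ^ y.length * (value u * (k ^ x.length - 1) + value x) * (k ^ x.length) ^ n +
        (value y * (k ^ x.length - 1) - k ^ y.length * value x) := by
  induction n generalizing u with
  | zero =>
    simp only [wordPow_zero, List.append_nil, value_append]
    push_cast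
    ring
  | succ n ih =>
    have := ih (u ++ x)
    rw [wordPow_succ, ← List.append_assoc, this, value_append]
    push_cast
    ring

theorem map_wordPow {α β : Type*} (f : α → β) (x : List α) (n : ℕ) :
    (wordPow x n).map f = wordPow (x.map f) n := by
  simp [wordPow]

/-- If `P' K^n + Q'` divides `P K^n + Q` for all `n`, the two are proportional. -/
theorem mul_eq_mul_of_forall_dvd {P Q P' Q' K : ℤ} (hK : 2 ≤ K) (hP' : 0 < P')
    (h : ∀ n : ℕ, P' * K ^ n + Q' ∣ P * K ^ n + Q) : P * Q' = P' * Q := by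
  -- This combination eliminates `K ^ n`, so one fixed number is divisible by all the divisors.
  set D := P' * Q - P * Q' with hD
  have hdvd : ∀ n : ℕ, P' * K ^ n + Q' ∣ D := fun n => by
    have : D = P' * (P * K ^ n + Q) - P * (P' * K ^ n + Q') := by rw [hD]; ring
    rw [this]
    exact dvd_sub ((h n).mul_left _) (Dvd.intro_left _ rfl)
  suffices D = 0 by linarith
  -- Since `n < K ^ n`, this choice makes `P' * K ^ n + Q'` exceed `|D|`.
  let n := (|D| + |Q'|).toNat
  have hn : |D| + |Q'| = n := (Int.toNat_of_nonneg (by positivity)).symm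
  have h1 : (n : ℤ) < K ^ n := by
    have : (n : ℤ) < 2 ^ n := by exact_mod_cast Nat.lt_two_pow_self
    exact this.trans_le (pow_le_pow_left₀ (by norm_num) hK n)
  have h2 : K ^ n ≤ P' * K ^ n := le_mul_of_one_le_left (by positivity) hP'
  refine Int.eq_zero_of_abs_lt_dvd (hdvd n) ?_
  have := neg_abs_le Q'
  linarith

/-- If the fraction with the digits `y` equals the one with the periodic digits `x`, both vanish. -/
theorem value_eq_zero_of_mul_eq (hk : 2 ≤ k) {x y : List (Fin k)} (hx : x ≠ [])
    (h : (value y : ℤ) * (k ^ x.length - 1) - k ^ y.length * value x = 0) :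
    value x = 0 ∧ value y = 0 := by
  have hlen : x.length ≠ 0 := by simpa using hx
  -- By coprimality `k ^ y.length` divides `value y`, which is smaller.
  have hcop : IsCoprime ((k : ℤ) ^ y.length) (k ^ x.length - 1) := by
    refine IsCoprime.pow_left ?_
    refine ⟨k ^ (x.length - 1), -1, ?_⟩
    rw [← pow_succ, Nat.sub_add_cancel (by omega)]
    ring
  have hdvd : (k : ℤ) ^ y.length ∣ value y :=
    hcop.dvd_of_dvd_mul_right ⟨value x, by linarith⟩
  have hy : value y = 0 :=
    Nat.eq_zero_of_dvd_of_lt (by exact_mod_cast hdvd) (value_lt hk y)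
  refine ⟨?_, hy⟩
  have hpos : (k : ℤ) ^ y.length ≠ 0 := by positivity
  simpa [hy, hpos, show k ≠ 0 by omega] using h

/-- Proportionality of the numerators and denominators of the words `u x^n y`. -/
theorem proportional_of_forall_dvd (hk : 2 ≤ k) {u x y : List (Fin k × Fin k)} (hx : x ≠ [])
    (hden : den (u ++ x) ≠ 0)
    (h : ∀ n, den (u ++ wordPow x n ++ y) ∣ num (u ++ wordPow x n ++ y)) :
    ((k : ℤ) ^ y.length * (num u * (k ^ x.length - 1) + num x)) *
        (den y * (k ^ x.length - 1) - k ^ y.length * den x) =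
      (k ^ y.length * (den u * (k ^ x.length - 1) + den x)) *
        (num y * (k ^ x.length - 1) - k ^ y.length * num x) := by
  have hlen : x.length ≠ 0 := by simpa using hx
  have hK : (2 : ℤ) ≤ k ^ x.length := by
    exact_mod_cast hk.trans (Nat.le_self_pow hlen k)
  refine mul_eq_mul_of_forall_dvd hK ?_ fun n => ?_
  · refine mul_pos (by positivity) ?_
    rcases Nat.eq_zero_or_pos (den x) with h0 | h0
    · have hu : 0 < den u := Nat.pos_of_ne_zero fun hu => hden (by simp [den_append, hu, h0])
      have := mul_pos (Int.natCast_pos.2 hu) (by linarith : (0 : ℤ) < k ^ x.length - 1)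
      positivity
    · have : (0 : ℤ) ≤ den u * (k ^ x.length - 1) :=
        mul_nonneg (by positivity) (by linarith)
      have : (0 : ℤ) < den x := by exact_mod_cast h0
      linarith
  · have h1 := value_pump (u.map Prod.fst) (x.map Prod.fst) (y.map Prod.fst) n
    have h2 := value_pump (u.map Prod.snd) (x.map Prod.snd) (y.map Prod.snd) n
    simp only [List.length_map, ← map_wordPow, ← List.map_append] at h1 h2
    simp only [num, den] at h ⊢
    rw [← h1, ← h2]
    exact mul_dvd_mul_left _ (Int.natCast_dvd_natCast.2 (h n))

/-- The first letter has denominator digit 0 and is not [0,0], so its numerator digit is positive.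
Hence `num (u ++ x)` is positive, and it is at least `2 * num u`. This is where leading [0,0] must
be excluded. -/
theorem num_lt_num_append (hk : 2 ≤ k) {u x : List (Fin k × Fin k)} (hx : x ≠ [])
    (hz : ∀ p ∈ u ++ x, (p.2 : ℕ) = 0) (hlead : NoLeadingZeroPair (u ++ x)) :
    num u < num (u ++ x) := by
  have hlen : x.length ≠ 0 := by simpa using hx
  have hK : 2 ≤ k ^ x.length := hk.trans (Nat.le_self_pow hlen k)
  obtain ⟨p, l, hpl⟩ := List.exists_cons_of_ne_nil (show u ++ x ≠ [] by simp [hx])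
  have hp1 : 0 < (p.1 : ℕ) := by
    refine Nat.pos_of_ne_zero fun h0 => hlead p (by simp [hpl]) ⟨h0, hz p (by simp [hpl])⟩
  have hpos : 0 < num (u ++ x) := by
    rw [hpl, num_cons]
    positivity
  rw [num_append] at hpos ⊢
  rcases Nat.eq_zero_or_pos (num u) with h0 | h0
  · simpa [h0] using hpos
  · nlinarith

/-- A word of `L` has a short prefix with vanishing denominator, or a short remainder. -/
theorem Admissible.length_lt_or {σ : Type*} [Fintype σ] (hk : 2 ≤ k)
    (M : DFA (Fin k × Fin k) σ) (hL : Admissible M.accepts) {z v : List (Fin k × Fin k)}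
    (hw : z ++ v ∈ M.accepts) (hz : ∀ p ∈ z, (p.2 : ℕ) = 0)
    (hv : ∀ p, v.head? = some p → (p.2 : ℕ) ≠ 0) :
    z.length < Fintype.card σ ∨ v.length < Fintype.card σ := by
  by_contra! hcon
  obtain ⟨q, u, x, y₁, rfl, -, hx, hu, hqx, hqy⟩ :=
    M.evalFrom_split (s := M.start) hcon.1 rfl
  obtain ⟨r, y₂, s, t, rfl, -, hs, hr, hrs, hrt⟩ :=
    M.evalFrom_split (s := M.eval (u ++ x ++ y₁)) hcon.2 rfl
  have hmem : ∀ i m, u ++ wordPow x i ++ y₁ ++ y₂ ++ wordPow s m ++ t ∈ M.accepts := by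
    intro i m
    rw [DFA.mem_accepts] at hw ⊢
    convert hw using 1
    simp only [DFA.eval] at hr hrt hqy ⊢
    simp only [DFA.evalFrom_of_append] at hqy hr hrt ⊢
    simp only [hu, evalFrom_wordPow M hqx, hqx] at hqy hr hrt ⊢
    simp only [hr, evalFrom_wordPow M hrs, hrs]
  -- The first letter of `y₂ ++ s` is that of `v`, with nonzero denominator digit.
  have hy₂s : den (y₂ ++ s) ≠ 0 := by
    obtain ⟨p, l, hpl⟩ := List.exists_cons_of_ne_nil (show y₂ ++ s ≠ [] by simp [hs])
    have := hv p (by simp [hpl])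
    rw [hpl, den_cons]
    have : 0 < (p.2 : ℕ) * k ^ l.length := by positivity
    omega
  have hprop : ∀ i, _ := fun i =>
    proportional_of_forall_dvd hk (u := u ++ wordPow x i ++ y₁ ++ y₂) (x := s) (y := t) hs
      (by rw [List.append_assoc, den_append]; omega) fun m => hL.den_dvd_num (hmem i m)
  have h0 := hprop 0
  have h1 := hprop 1
  have hw1 : wordPow x 1 = x := by simp [wordPow]
  have hu0 : ∀ p ∈ u ++ x, (p.2 : ℕ) = 0 := fun p hp => hz p (List.mem_append_left _ hp)
  have hdu : den u = 0 := den_eq_zero fun p hp => hu0 p (by simp [hp])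
  have hdux : den (u ++ x) = 0 := den_eq_zero hu0
  have hlt := num_lt_num_append hk hx hu0 fun p hp =>
    (hL.1 _ hw).1 p (by
      cases hux : u ++ x with
      | nil => simp [hux] at hp
      | cons a l => simpa [hux] using hp)
  rw [hw1] at h1
  rw [wordPow_zero, List.append_nil] at h0
  rw [List.append_assoc, num_append, den_append] at h0 h1
  rw [hdu] at h0
  rw [hdux] at h1
  have hK : (2 : ℤ) ≤ k ^ s.length := by
    exact_mod_cast hk.trans (Nat.le_self_pow (by simpa using hs) k)
  set Q' : ℤ := den t * (k ^ s.length - 1) - k ^ t.length * den s with hQ'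
  set Q : ℤ := num t * (k ^ s.length - 1) - k ^ t.length * num s with hQ
  -- Passing from `i = 0` to `i = 1` affects only the numerator prefix, since `u` and `u ++ x` both
  -- have denominator 0; the two proportionalities are subtracted.
  have hkey : (k : ℤ) ^ t.length * (((num (u ++ x) : ℤ) - num u) * k ^ (y₁ ++ y₂).length *
      (k ^ s.length - 1)) * Q' = 0 := by
    push_cast at h0 h1
    linear_combination h1 - h0
  have hQ'0 : Q' = 0 := by
    refine (mul_eq_zero.1 hkey).resolve_left (ne_of_gt ?_)
    have h1 : (0 : ℤ) < num (u ++ x) - num u := by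
      have : (num u : ℤ) < num (u ++ x) := by exact_mod_cast hlt
      linarith
    have h2 : (0 : ℤ) < k ^ s.length - 1 := by linarith
    positivity
  -- The proportionality now reads P' Q = 0, and P' = 0 would give `den (y₂ ++ s) = 0`.
  have hQ0 : Q = 0 := by
    rw [hQ'0, mul_zero] at h0
    refine (mul_eq_zero.1 h0.symm).resolve_left (mul_ne_zero (by positivity) fun h => hy₂s ?_)
    have h2 : (0 : ℤ) < k ^ s.length - 1 := by linarith
    have h3 : ((0 * k ^ (y₁ ++ y₂).length + den (y₁ ++ y₂) : ℕ) : ℤ) * (k ^ s.length - 1) = 0 ∧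
        (den s : ℤ) = 0 := (add_eq_zero_iff_of_nonneg (by positivity) (by positivity)).1 h
    have h4 := (mul_eq_zero.1 h3.1).resolve_right h2.ne'
    have h5 : den (y₁ ++ y₂) = 0 := by simpa using h4
    have h6 : den s = 0 := by exact_mod_cast h3.2
    rw [den_append, Nat.add_eq_zero_iff] at h5
    simp [den_append, h5.2, h6]
  have hd := value_eq_zero_of_mul_eq hk (x := s.map Prod.snd) (y := t.map Prod.snd) (by simpa)
    (by simpa [hQ', den] using hQ'0)
  have hn := value_eq_zero_of_mul_eq hk (x := s.map Prod.fst) (y := t.map Prod.fst) (by simpa)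
    (by simpa [hQ, num] using hQ0)
  have hst : ∀ p ∈ s ++ t, IsZeroPair p :=
    eq_zero_of_num_den_eq_zero hk (by rw [num_append]; simp [num, hn.1, hn.2])
      (by rw [den_append]; simp [den, hd.1, hd.2])
  have hne : s ++ t ≠ [] := by simp [hs]
  refine (hL.1 _ hw).2 ((s ++ t).getLast hne) ?_ (hst _ (List.getLast_mem hne))
  rw [← List.getLast?_eq_some_getLast hne, List.append_assoc y₂, ← List.append_assoc,
    List.getLast?_append_of_ne_nil _ hne]

/-- The quotients or the denominators are bounded in terms of the number of states. -/
theorem Admissible.num_le_or_den_lt {σ : Type*} [Fintype σ] (hk : 2 ≤ k)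
    (M : DFA (Fin k × Fin k) σ) (hL : Admissible M.accepts) {w : List (Fin k × Fin k)}
    (hw : w ∈ M.accepts) :
    num w ≤ k ^ Fintype.card σ * den w ∨ den w < k ^ Fintype.card σ := by
  set z := w.takeWhile fun p => decide ((p.2 : ℕ) = 0) with hzdef
  set v := w.dropWhile fun p => decide ((p.2 : ℕ) = 0) with hvdef
  have hzv : z ++ v = w := List.takeWhile_append_dropWhile
  have hz : ∀ p ∈ z, (p.2 : ℕ) = 0 := fun p hp => by simpa using List.mem_takeWhile_imp hp
  have hv : ∀ p, v.head? = some p → (p.2 : ℕ) ≠ 0 := fun p hp => by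
    have := List.head?_dropWhile_not (fun p : Fin k × Fin k => decide ((p.2 : ℕ) = 0)) w
    rw [← hvdef, hp] at this
    simpa using this
  have hden : den w = den v := by rw [← hzv, den_append, den_eq_zero hz]; simp
  rcases hL.length_lt_or hk M (hzv ▸ hw) hz hv with h | h
  · left
    cases hv' : v with
    | nil => exact absurd (by rw [hden, hv', den_nil]) (hL.2.1 w hw)
    | cons p l =>
      have hp : 1 ≤ (p.2 : ℕ) := Nat.pos_of_ne_zero (hv p (by simp [hv']))
      -- The leading denominator digit of `v` is at least 1, so `den w` falls short of `k ^
      -- w.length` by a factor of at most `k ^ (z.length + 1)`.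
      have hdl : k ^ l.length ≤ den w := by
        rw [hden, hv', den_cons]
        exact (Nat.le_mul_of_pos_left _ hp).trans (Nat.le_add_right _ _)
      calc num w ≤ k ^ w.length := (num_lt hk w).le
        _ = k ^ (z.length + 1) * k ^ l.length := by
          rw [← hzv, hv', ← pow_add]
          simp [add_assoc, add_comm 1]
        _ ≤ k ^ Fintype.card σ * den w :=
          Nat.mul_le_mul (Nat.pow_le_pow_right (by omega) h) hdl
  · right
    rw [hden]
    exact (den_lt hk v).trans_le (Nat.pow_le_pow_right (by omega) h.le)

end Pumping

/-! ### Subset construction as an explicit table -/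

section Subsets

open Classical in
/-- The number below `2 ^ n` whose binary digits are given by `P`. -/
noncomputable def bits (P : ℕ → Prop) (n : ℕ) : ℕ :=
  Nat.rec 0 (fun i r => r + if P i then 2 ^ i else 0) n

open Classical in
theorem bits_succ (P : ℕ → Prop) (n : ℕ) :
    bits P (n + 1) = bits P n + if P n then 2 ^ n else 0 := rfl

theorem bits_lt (P : ℕ → Prop) (n : ℕ) : bits P n < 2 ^ n := by
  induction n with
  | zero => simp [bits]
  | succ n ih =>
    rw [bits_succ, pow_succ]
    split <;> omega

theorem bits_div_mod (P : ℕ → Prop) {n i : ℕ} (hi : i < n) :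
    bits P n / 2 ^ i % 2 = 1 ↔ P i := by
  induction n with
  | zero => omega
  | succ n ih =>
    rw [bits_succ]
    rcases Nat.lt_succ_iff_lt_or_eq.1 hi with h | rfl
    · rw [← ih h]
      split
      · obtain ⟨j, rfl⟩ := Nat.exists_eq_add_of_lt h
        have : 2 ^ (i + j + 1) = 2 ^ i * (2 * 2 ^ j) := by ring
        rw [this, Nat.add_mul_div_left _ _ (by positivity), Nat.add_mul_mod_self_left]
      · simp
    · have hlt := bits_lt P i
      split
      · rw [Nat.add_div_right _ (by positivity), Nat.div_eq_of_lt hlt]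
        simpa
      · rw [add_zero, Nat.div_eq_of_lt hlt]
        simpa

/-- Subsets of `ℕ` are coded by their binary digits, with the digit of `0` complemented, so that
`0` codes `{0}`. -/
def HasState (t s : ℕ) : Prop := (t / 2 ^ s + (1 - s)) % 2 = 1

theorem hasState_zero (s : ℕ) : HasState 0 s ↔ s = 0 := by
  simp only [HasState, Nat.zero_div, zero_add]
  omega

/-- The code of `{s < n | P s}`. -/
noncomputable def subsetMask (P : ℕ → Prop) (n : ℕ) : ℕ :=
  bits (fun s => (P s ∧ s ≠ 0) ∨ (¬ P s ∧ s = 0)) n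

theorem hasState_subsetMask (P : ℕ → Prop) {n s : ℕ} (hs : s < n) :
    HasState (subsetMask P n) s ↔ P s := by
  have h := bits_div_mod (fun s => (P s ∧ s ≠ 0) ∨ (¬ P s ∧ s = 0)) hs
  rw [← subsetMask] at h
  rw [HasState]
  rcases Nat.eq_zero_or_pos s with h0 | h0
  · have : ¬ P s ↔ subsetMask P n / 2 ^ s % 2 = 1 := by rw [h]; simp [h0]
    by_cases hP : P s <;> simp only [hP, iff_true, iff_false, not_true, not_false_iff, true_iff,
      false_iff] at this ⊢ <;> omega
  · have : P s ↔ subsetMask P n / 2 ^ s % 2 = 1 := by rw [h]; simp [h0.ne']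
    rw [this]
    omega

/-- The successors below `M`, under the relation `R x`, of the states in the set coded by `t`. -/
noncomputable def subsetStep (M : ℕ) (R : ℕ → ℕ → ℕ → Prop) (t x : ℕ) : ℕ :=
  subsetMask (fun s' => ∃ s < M, HasState t s ∧ R x s s') M

open Classical in
/-- The subset construction, as a transition table, for the nondeterministic automaton with
states below `M`, initial state `0`, transition relation `R` and accepting states `F`. -/
noncomputable def subsetCode (k M : ℕ) (R : ℕ → ℕ → ℕ → Prop) (F : ℕ → Prop) : AutCode :=
  (2 ^ M - 1, (List.range (2 ^ M * k)).map fun i => subsetStep M R (i / k) (i % k),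
    (List.range (2 ^ M)).filter fun t => ∃ s < M, HasState t s ∧ F s)

/-- The nondeterministic automaton with states below `M` and initial state `0`. -/
def boundedNFA (k M : ℕ) (R : ℕ → ℕ → ℕ → Prop) (F : ℕ → Prop) : NFA (Fin k) ℕ where
  step s x := {s' | s' < M ∧ R x s s'}
  start := {0}
  accept := {s | F s}

theorem boundedNFA_eval_lt {k M : ℕ} (hM : 0 < M) {R : ℕ → ℕ → ℕ → Prop} {F : ℕ → Prop}
    {x : List (Fin k)} {s : ℕ} (hs : s ∈ (boundedNFA k M R F).eval x) : s < M := by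
  induction x using List.reverseRecOn with
  | nil =>
    have : s = 0 := by simpa [boundedNFA] using hs
    omega
  | append_singleton x d ih =>
    rw [NFA.eval_append_singleton, NFA.mem_stepSet] at hs
    obtain ⟨s₀, -, h⟩ := hs
    exact h.1

theorem hasState_subsetCode_eval {k M : ℕ} (hM : 0 < M) {R : ℕ → ℕ → ℕ → Prop} {F : ℕ → Prop}
    (x : List (Fin k)) {s : ℕ} (hs : s < M) :
    HasState ((subsetCode k M R F).toDFA (Equiv.refl (Fin k))|>.eval x).val s ↔
      s ∈ (boundedNFA k M R F).eval x := by
  induction x using List.reverseRecOn generalizing s with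
  -- An `AutCode` always starts in `0`; the complemented digit makes this the code of the start set
  -- `{0}`.
  | nil => simpa [boundedNFA, AutCode.toDFA] using hasState_zero s
  | append_singleton x d ih =>
    rw [DFA.eval_append_singleton, NFA.eval_append_singleton, NFA.mem_stepSet]
    generalize ((subsetCode k M R F).toDFA (Equiv.refl (Fin k))).eval x = t at ih ⊢
    have hpow : 2 ^ M - 1 + 1 = 2 ^ M := Nat.sub_add_cancel Nat.one_le_two_pow
    have ht : t.val < 2 ^ M := t.isLt.trans_eq hpow
    -- The index is inside the table, so the default value of `getD` plays no role.
    have hidx : t.val * k + d.val < 2 ^ M * k := by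
      calc t.val * k + d.val < t.val * k + k := by omega
        _ = (t.val + 1) * k := by ring
        _ ≤ 2 ^ M * k := Nat.mul_le_mul_right k ht
    have hk : 0 < k := d.pos
    have hdiv : (t.val * k + d.val) / k = t.val := by
      rw [mul_comm, Nat.mul_add_div hk, Nat.div_eq_of_lt d.isLt, add_zero]
    have hmod : (t.val * k + d.val) % k = d.val := by
      rw [mul_comm, Nat.mul_add_mod, Nat.mod_eq_of_lt d.isLt]
    have hstep : (((subsetCode k M R F).toDFA (Equiv.refl (Fin k))).step t d).val =
        subsetStep M R t d := by
      have hlt : subsetStep M R t d < 2 ^ M := bits_lt _ _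
      simp only [AutCode.toDFA, subsetCode, Fin.ofNat, Equiv.refl_apply, hpow]
      rw [List.getD_eq_getElem _ _ (by simpa using hidx)]
      simp [hdiv, hmod, Nat.mod_eq_of_lt hlt]
    rw [hstep, subsetStep, hasState_subsetMask _ hs]
    constructor
    · rintro ⟨s₀, hs₀, h, hR⟩
      exact ⟨s₀, (ih hs₀).1 h, hs, hR⟩
    · rintro ⟨s₀, h, -, hR⟩
      have hs₀ := boundedNFA_eval_lt hM h
      exact ⟨s₀, hs₀, (ih hs₀).2 h, hR⟩

theorem subsetCode_lang {k M : ℕ} (hM : 0 < M) {R : ℕ → ℕ → ℕ → Prop} {F : ℕ → Prop} :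
    (subsetCode k M R F).lang k = (boundedNFA k M R F).accepts := by
  ext x
  have hpow : 2 ^ M - 1 + 1 = 2 ^ M := Nat.sub_add_cancel Nat.one_le_two_pow
  have key := fun s hs => hasState_subsetCode_eval (R := R) (F := F) hM x (s := s) hs
  rw [AutCode.lang, DFA.mem_accepts, NFA.mem_accepts]
  generalize ((subsetCode k M R F).toDFA (Equiv.refl (Fin k))).eval x = t at key ⊢
  have ht : t.val < 2 ^ M := t.isLt.trans_eq hpow
  change t.val ∈ (subsetCode k M R F).2.2 ↔ _
  simp only [subsetCode, List.mem_filter, List.mem_range, ht, true_and, decide_eq_true_eq]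
  constructor
  · rintro ⟨s, hs, h, hF⟩
    exact ⟨s, hF, (key s hs).1 h⟩
  · rintro ⟨s, hF, h⟩
    have hs := boundedNFA_eval_lt hM h
    exact ⟨s, hs, (key s hs).2 h, hF⟩

end Subsets

/-! ### Automata with carries for a fixed quotient or denominator -/

section Carry

/-- The transition function of the automaton over `Σ_k²` that `c` describes. -/
def pairStep (k : ℕ) (c : AutCode) (q i : ℕ) : ℕ := c.2.1.getD (q * (k * k) + i) 0 % (c.1 + 1)

/-- The transitions of an automaton that reads the digits of a word `x`, guesses a word `w` over
`Σ_k²` of the same length, and keeps the state reached by `w` together with `num w - a * value x`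
and `den w - b * value x`. -/
def CarryStep (k : ℕ) (c : AutCode) (a b x s s' : ℕ) : Prop :=
  ∃ p < k * k, s'.unpair.1 = pairStep k c s.unpair.1 p ∧
    s'.unpair.2.unpair.1 + a * x = s.unpair.2.unpair.1 * k + p / k ∧
    s'.unpair.2.unpair.2 + b * x = s.unpair.2.unpair.2 * k + p % k

/-- A strict bound for the states of the automaton with transitions `CarryStep`. -/
def carryBound (c : AutCode) (a b e : ℕ) : ℕ :=
  Nat.pair c.1 (Nat.pair (a + b + e) (a + b + e)) + 1

/-- The accepting states: those where `num w = a * value x` and `den w = b * value x + e`. -/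
def CarryAccept (c : AutCode) (e s : ℕ) : Prop :=
  s.unpair.1 ∈ c.2.2 ∧ s.unpair.2.unpair.1 = 0 ∧ s.unpair.2.unpair.2 = e

/-- An automaton for the words `x` with `num w = a * value x` and `den w = b * value x + e` for
some `w` of the same length in the language of `c`. -/
noncomputable def carryCode (k : ℕ) (c : AutCode) (a b e : ℕ) : AutCode :=
  subsetCode k (carryBound c a b e) (CarryStep k c a b) (CarryAccept c e)

theorem pair_le_pair {a b a' b' : ℕ} (h : a ≤ a') (h' : b ≤ b') :
    Nat.pair a b ≤ Nat.pair a' b' := by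
  have h₁ : StrictMono fun i => Nat.pair i b := fun _ _ h => Nat.pair_lt_pair_left b h
  have h₂ : StrictMono fun i => Nat.pair a' i := fun _ _ h => Nat.pair_lt_pair_right a' h
  exact (h₁.monotone h).trans (h₂.monotone h')

theorem pairDFA_step_val (k : ℕ) (c : AutCode) (q : Fin (c.1 + 1)) (p : Fin k × Fin k) :
    ((c.toDFA finProdFinEquiv).step q p).val = pairStep k c q (p.2 + k * p.1) := rfl

/-- The carry at an inner position is natural and bounded if the final one is. -/
theorem exists_carry {k a H C x d n p X N : ℕ} (ha : a ≤ H) (hC : C ≤ H)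
    (hd : d < k) (hp : p < k) (h : C + a * X = N) (hX : X = x * k + d) (hN : N = n * k + p) :
    ∃ C₀ ≤ H, C₀ + a * x = n ∧ C + a * d = C₀ * k + p := by
  subst hX hN
  have hk : 0 < k := by omega
  -- Otherwise `a * X ≥ (n + 1) * k > N`.
  have hle : a * x ≤ n := by
    by_contra! hlt
    have : (n + 1) * k ≤ a * x * k := Nat.mul_le_mul_right k hlt
    nlinarith
  obtain ⟨C₀, rfl⟩ := Nat.exists_eq_add_of_le' hle
  have heq : C + a * d = C₀ * k + p := by nlinarith
  refine ⟨C₀, ?_, rfl, heq⟩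
  -- `C₀ * k ≤ C + a * d ≤ H + H * (k - 1) = H * k`.
  by_contra! hlt
  have h1 : (H + 1) * k ≤ C₀ * k := Nat.mul_le_mul_right k hlt
  have h2 : a * d ≤ H * d := Nat.mul_le_mul_right d ha
  have h3 : H * (d + 1) ≤ H * k := Nat.mul_le_mul_left H hd
  nlinarith

theorem exists_word_of_mem_eval {k M : ℕ} {c : AutCode} {a b : ℕ} {F : ℕ → Prop}
    {x : List (Fin k)} {s : ℕ} (hs : s ∈ (boundedNFA k M (CarryStep k c a b) F).eval x) :
    ∃ w : List (Fin k × Fin k), w.length = x.length ∧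
      ((c.toDFA finProdFinEquiv).eval w).val = s.unpair.1 ∧
      s.unpair.2.unpair.1 + a * value x = num w ∧
      s.unpair.2.unpair.2 + b * value x = den w := by
  induction x using List.reverseRecOn generalizing s with
  | nil =>
    obtain rfl : s = 0 := by simpa [boundedNFA] using hs
    exact ⟨[], by simp [AutCode.toDFA]⟩
  | append_singleton x d ih =>
    rw [NFA.eval_append_singleton, NFA.mem_stepSet] at hs
    obtain ⟨s₀, hs₀, -, p, hp, hq, hC, hV⟩ := hs
    obtain ⟨w, hl, hw, hn, hd⟩ := ih hs₀
    have hk : 0 < k := d.pos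
    let r : Fin k × Fin k := (⟨p / k, Nat.div_lt_of_lt_mul hp⟩, ⟨p % k, Nat.mod_lt _ hk⟩)
    refine ⟨w ++ [r], by simp [hl], ?_, ?_, ?_⟩
    · rw [DFA.eval_append_singleton, pairDFA_step_val, hw, hq]
      simp only [r, Nat.mod_add_div]
    · rw [num_concat, value_concat, ← hn]
      simp only [r]
      linarith
    · rw [den_concat, value_concat, ← hd]
      simp only [r]
      linarith

/-- The induction removes last digits. By `exists_carry` the carries before them are again natural
and at most `a + b + e`, so confining the automaton to finitely many states loses no run. -/
theorem mem_eval_of_word {k : ℕ} {c : AutCode} {a b e : ℕ} {F : ℕ → Prop} {x : List (Fin k)}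
    {w : List (Fin k × Fin k)} (hl : w.length = x.length) {C V : ℕ} (hC : C ≤ a + b + e)
    (hV : V ≤ a + b + e) (hn : C + a * value x = num w) (hd : V + b * value x = den w) :
    Nat.pair ((c.toDFA finProdFinEquiv).eval w).val (Nat.pair C V) ∈
      (boundedNFA k (carryBound c a b e) (CarryStep k c a b) F).eval x := by
  induction x using List.reverseRecOn generalizing w C V with
  | nil =>
    obtain rfl : w = [] := by simpa using hl
    obtain rfl : C = 0 := by simpa using hn
    obtain rfl : V = 0 := by simpa using hd
    simp [boundedNFA, AutCode.toDFA, Nat.pair]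
  | append_singleton x d ih =>
    obtain ⟨w, p, rfl⟩ := List.eq_nil_or_concat' w |>.resolve_left (by rintro rfl; simp at hl)
    obtain ⟨C₀, hC₀, hn₀, hCC⟩ := exists_carry (by omega) hC d.isLt p.1.isLt hn
      (value_concat x d) (num_concat w p)
    obtain ⟨V₀, hV₀, hd₀, hVV⟩ := exists_carry (by omega) hV d.isLt p.2.isLt hd
      (value_concat x d) (den_concat w p)
    rw [NFA.eval_append_singleton, NFA.mem_stepSet]
    have hk : 0 < k := d.pos
    refine ⟨_, ih (by simpa using hl) hC₀ hV₀ hn₀ hd₀, ?_, p.2 + k * p.1, ?_, ?_, ?_, ?_⟩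
    · exact Nat.lt_succ_of_le (pair_le_pair (Nat.le_of_lt_succ (Fin.isLt _)) (pair_le_pair hC hV))
    · exact (finProdFinEquiv p).isLt
    · simp only [Nat.unpair_pair, DFA.eval_append_singleton, pairDFA_step_val]
    · simp only [Nat.unpair_pair]
      rw [hCC, Nat.add_mul_div_left _ _ hk, Nat.div_eq_of_lt p.2.isLt, zero_add]
    · simp only [Nat.unpair_pair]
      rw [hVV, Nat.add_mul_mod_self_left, Nat.mod_eq_of_lt p.2.isLt]

/-- Used with `(a, 1, 0)`, where `x` represents the denominator and `a` is the quotient, and with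
`(b, 0, b)`, where `x` represents the quotient and `b` is the denominator. -/
theorem mem_carryCode_lang {k : ℕ} (c : AutCode) (a b e : ℕ) (x : List (Fin k)) :
    x ∈ (carryCode k c a b e).lang k ↔
      ∃ w ∈ c.pairLang k, w.length = x.length ∧ num w = a * value x ∧
        den w = b * value x + e := by
  rw [carryCode, subsetCode_lang (M := carryBound c a b e) (Nat.succ_pos _), NFA.mem_accepts]
  constructor
  · rintro ⟨s, ⟨hF, hC, hV⟩, hs⟩
    obtain ⟨w, hl, hq, hn, hd⟩ := exists_word_of_mem_eval hs
    exact ⟨w, show _ ∈ c.2.2 from hq ▸ hF, hl, by omega, by omega⟩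
  · rintro ⟨w, hw, hl, hn, hd⟩
    refine ⟨_, ?_, mem_eval_of_word hl (Nat.zero_le _) (V := e) (by omega) (by omega) (by omega)⟩
    change CarryAccept _ _ _
    simp only [CarryAccept, Nat.unpair_pair, and_self, and_true]
    exact hw

end Carry

/-! ### Primitive recursiveness of the construction -/

section Primrec

variable {α : Type*} [Primcodable α]

theorem primrec_pow {f g : α → ℕ} (hf : Primrec f) (hg : Primrec g) :
    Primrec fun x => f x ^ g x :=
  (Primrec₂.unpaired'.1 Nat.Primrec.pow).comp hf hg

theorem primrec_add {f g : α → ℕ} (hf : Primrec f) (hg : Primrec g) :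
    Primrec fun x => f x + g x :=
  Primrec.nat_add.comp hf hg

theorem primrec_mul {f g : α → ℕ} (hf : Primrec f) (hg : Primrec g) :
    Primrec fun x => f x * g x :=
  Primrec.nat_mul.comp hf hg

theorem primrecPred_eq {f g : α → ℕ} (hf : Primrec f) (hg : Primrec g) :
    PrimrecPred fun x => f x = g x :=
  Primrec.eq.comp hf hg

/-- The quantifiers of the construction range over states below `M` or letters below `k * k`, so
this closure property handles them all. -/
theorem primrecPred_exists_lt {n : α → ℕ} {P : α → ℕ → Prop} (hn : Primrec n)
    (hP : PrimrecPred fun z : α × ℕ => P z.1 z.2) : PrimrecPred fun x => ∃ i < n x, P x i :=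
  ((PrimrecRel.exists_mem_list (R := fun (i : ℕ) x => P x i)
    (hP.comp (Primrec.snd.pair Primrec.fst))).comp (Primrec.list_range.comp hn) Primrec.id).of_eq
      fun x => by simp

theorem primrecPred_mem_list {l : α → List ℕ} {n : α → ℕ} (hl : Primrec l) (hn : Primrec n) :
    PrimrecPred fun x => n x ∈ l x :=
  ((PrimrecRel.exists_mem_list (R := fun a b : ℕ => a = b) Primrec.eq).comp hl hn).of_eq
    fun x => by simp

theorem primrec_filter_range {n : α → ℕ} {P : α → ℕ → Prop} [∀ x i, Decidable (P x i)]
    (hn : Primrec n) (hP : PrimrecPred fun z : α × ℕ => P z.1 z.2) :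
    Primrec fun x => (List.range (n x)).filter fun i => P x i :=
  (PrimrecRel.listFilter (R := fun (i : ℕ) x => P x i)
    (hP.comp (Primrec.snd.pair Primrec.fst))).comp (Primrec.list_range.comp hn) Primrec.id

theorem primrec_bits {n : α → ℕ} {P : α → ℕ → Prop} (hn : Primrec n)
    (hP : PrimrecPred fun z : α × ℕ => P z.1 z.2) : Primrec fun x => bits (P x) (n x) := by
  classical
  refine (Primrec.nat_rec' (f := n) (g := fun _ => 0)
    (h := fun x ir => ir.2 + if P x ir.1 then 2 ^ ir.1 else 0) hn (Primrec.const 0) ?_).of_eq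
      fun x => ?_
  · have h1 : Primrec fun z : α × ℕ × ℕ => z.2.1 := Primrec.fst.comp Primrec.snd
    exact primrec_add (Primrec.snd.comp Primrec.snd)
      (Primrec.ite (hP.comp (Primrec.fst.pair h1)) (primrec_pow (Primrec.const 2) h1)
        (Primrec.const 0))
  · rw [bits]

theorem primrecPred_hasState {t s : α → ℕ} (ht : Primrec t) (hs : Primrec s) :
    PrimrecPred fun x => HasState (t x) (s x) :=
  primrecPred_eq (Primrec.nat_mod.comp (primrec_add
    (Primrec.nat_div.comp ht (primrec_pow (Primrec.const 2) hs))
    (Primrec.nat_sub.comp (Primrec.const 1) hs)) (Primrec.const 2)) (Primrec.const 1)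

theorem primrec_subsetMask {n : α → ℕ} {P : α → ℕ → Prop} (hn : Primrec n)
    (hP : PrimrecPred fun z : α × ℕ => P z.1 z.2) : Primrec fun x => subsetMask (P x) (n x) := by
  have h0 := primrecPred_eq (α := α × ℕ) Primrec.snd (Primrec.const 0)
  exact primrec_bits hn ((hP.and h0.not).or (hP.not.and h0))

theorem primrec_subsetStep {M t d : α → ℕ} {R : α → ℕ → ℕ → ℕ → Prop} (hM : Primrec M)
    (hR : PrimrecPred fun z : α × ℕ × ℕ × ℕ => R z.1 z.2.1 z.2.2.1 z.2.2.2) (ht : Primrec t)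
    (hd : Primrec d) : Primrec fun x => subsetStep (M x) (R x) (t x) (d x) := by
  refine primrec_subsetMask hM (primrecPred_exists_lt (hM.comp Primrec.fst) ?_)
  have h1 : Primrec fun z : (α × ℕ) × ℕ => z.1.1 := Primrec.fst.comp Primrec.fst
  have h2 : Primrec fun z : (α × ℕ) × ℕ => z.1.2 := Primrec.snd.comp Primrec.fst
  exact (primrecPred_hasState (ht.comp h1) Primrec.snd).and
    (hR.comp (h1.pair ((hd.comp h1).pair (Primrec.snd.pair h2))))

theorem primrec_subsetCode {k M : α → ℕ} {R : α → ℕ → ℕ → ℕ → Prop} {F : α → ℕ → Prop}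
    (hk : Primrec k) (hM : Primrec M)
    (hR : PrimrecPred fun z : α × ℕ × ℕ × ℕ => R z.1 z.2.1 z.2.2.1 z.2.2.2)
    (hF : PrimrecPred fun z : α × ℕ => F z.1 z.2) :
    Primrec fun x => subsetCode (k x) (M x) (R x) (F x) := by
  classical
  have hpow : Primrec fun x => 2 ^ M x := primrec_pow (Primrec.const 2) hM
  refine (Primrec.nat_sub.comp hpow (Primrec.const 1)).pair ((Primrec.list_map
    (Primrec.list_range.comp (primrec_mul hpow hk)) ?_).pair (primrec_filter_range hpow ?_))
  · have hk' : Primrec fun z : α × ℕ => k z.1 := hk.comp Primrec.fst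
    refine primrec_subsetStep (hM.comp Primrec.fst) (R := fun z : α × ℕ => R z.1) ?_
      (Primrec.nat_div.comp Primrec.snd hk') (Primrec.nat_mod.comp Primrec.snd hk')
    exact hR.comp ((Primrec.fst.comp Primrec.fst).pair Primrec.snd)
  · refine primrecPred_exists_lt (hM.comp Primrec.fst) ?_
    exact (primrecPred_hasState (Primrec.snd.comp Primrec.fst) Primrec.snd).and
      (hF.comp ((Primrec.fst.comp Primrec.fst).pair Primrec.snd))

theorem primrec_pairStep {k q i : α → ℕ} {c : α → AutCode} (hk : Primrec k) (hc : Primrec c)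
    (hq : Primrec q) (hi : Primrec i) :
    Primrec fun x => pairStep (k x) (c x) (q x) (i x) :=
  Primrec.nat_mod.comp
    ((Primrec.list_getD 0).comp (Primrec.fst.comp (Primrec.snd.comp hc))
      (primrec_add (primrec_mul hq (primrec_mul hk hk)) hi))
    (Primrec.succ.comp (Primrec.fst.comp hc))

theorem primrecPred_carryStep {k a b d s s' : α → ℕ} {c : α → AutCode} (hk : Primrec k)
    (hc : Primrec c) (ha : Primrec a) (hb : Primrec b) (hd : Primrec d) (hs : Primrec s)
    (hs' : Primrec s') :
    PrimrecPred fun x => CarryStep (k x) (c x) (a x) (b x) (d x) (s x) (s' x) := by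
  have hf : Primrec fun z : α × ℕ => z.1 := Primrec.fst
  have h1 : ∀ {g : α → ℕ}, Primrec g → Primrec fun x => (g x).unpair.1 := fun hg =>
    Primrec.fst.comp (Primrec.unpair.comp hg)
  have h2 : ∀ {g : α → ℕ}, Primrec g → Primrec fun x => (g x).unpair.2 := fun hg =>
    Primrec.snd.comp (Primrec.unpair.comp hg)
  refine primrecPred_exists_lt (primrec_mul hk hk) (PrimrecPred.and ?_ (PrimrecPred.and ?_ ?_))
  · exact primrecPred_eq ((h1 hs').comp hf)
      (primrec_pairStep (hk.comp hf) (hc.comp hf) ((h1 hs).comp hf) Primrec.snd)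
  · exact primrecPred_eq ((primrec_add (h1 (h2 hs')) (primrec_mul ha hd)).comp hf)
      (primrec_add ((primrec_mul (h1 (h2 hs)) hk).comp hf)
        (Primrec.nat_div.comp Primrec.snd (hk.comp hf)))
  · exact primrecPred_eq ((primrec_add (h2 (h2 hs')) (primrec_mul hb hd)).comp hf)
      (primrec_add ((primrec_mul (h2 (h2 hs)) hk).comp hf)
        (Primrec.nat_mod.comp Primrec.snd (hk.comp hf)))

theorem primrecPred_carryAccept {e s : α → ℕ} {c : α → AutCode} (hc : Primrec c)
    (he : Primrec e) (hs : Primrec s) : PrimrecPred fun x => CarryAccept (c x) (e x) (s x) := by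
  have h := Primrec.unpair.comp hs
  have h' := Primrec.unpair.comp (Primrec.snd.comp h)
  exact (primrecPred_mem_list (Primrec.snd.comp (Primrec.snd.comp hc)) (Primrec.fst.comp h)).and
    ((primrecPred_eq (Primrec.fst.comp h') (Primrec.const 0)).and
      (primrecPred_eq (Primrec.snd.comp h') he))

theorem primrec_carryCode {k a b e : α → ℕ} {c : α → AutCode} (hk : Primrec k) (hc : Primrec c)
    (ha : Primrec a) (hb : Primrec b) (he : Primrec e) :
    Primrec fun x => carryCode (k x) (c x) (a x) (b x) (e x) := by
  have hH := primrec_add (primrec_add ha hb) he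
  refine primrec_subsetCode hk (M := fun x => carryBound (c x) (a x) (b x) (e x))
    (Primrec.succ.comp (Primrec₂.natPair.comp (Primrec.fst.comp hc) (Primrec₂.natPair.comp hH hH)))
    ?_ ?_
  · have h2 : Primrec fun z : α × ℕ × ℕ × ℕ => z.2 := Primrec.snd
    exact primrecPred_carryStep (hk.comp Primrec.fst) (hc.comp Primrec.fst) (ha.comp Primrec.fst)
      (hb.comp Primrec.fst) (Primrec.fst.comp h2) (Primrec.fst.comp (Primrec.snd.comp h2))
      (Primrec.snd.comp (Primrec.snd.comp h2))
  · exact primrecPred_carryAccept (hc.comp Primrec.fst) (he.comp Primrec.fst) Primrec.snd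

end Primrec

/-! ### The decomposition and its correctness -/

section Decomposition

/-- The computed decomposition: all quotients up to, and all denominators below, `k` to the
number of states. -/
noncomputable def decomp (k : ℕ) (c : AutCode) : DecompCode :=
  ((List.range (k ^ (c.1 + 1) + 1)).map fun a => (a, carryCode k c a 1 0),
    (List.range (k ^ (c.1 + 1))).map fun b => (b, carryCode k c b 0 b))

theorem primrec_decomp : Primrec fun z : ℕ × AutCode => decomp z.1 z.2 := by
  have hpow : Primrec fun z : ℕ × AutCode => z.1 ^ (z.2.1 + 1) :=
    primrec_pow Primrec.fst (Primrec.succ.comp (Primrec.fst.comp Primrec.snd))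
  have hk : Primrec fun z : (ℕ × AutCode) × ℕ => z.1.1 := Primrec.fst.comp Primrec.fst
  have hc : Primrec fun z : (ℕ × AutCode) × ℕ => z.1.2 := Primrec.snd.comp Primrec.fst
  refine (Primrec.list_map (Primrec.list_range.comp (Primrec.succ.comp hpow)) ?_).pair
    (Primrec.list_map (Primrec.list_range.comp hpow) ?_)
  · exact Primrec.snd.pair
      (primrec_carryCode hk hc Primrec.snd (Primrec.const 1) (Primrec.const 0))
  · exact Primrec.snd.pair (primrec_carryCode hk hc Primrec.snd (Primrec.const 0) Primrec.snd)

theorem isNatAutomatic_lang (k : ℕ) (c : AutCode) : IsNatAutomatic k (valueSet (c.lang k)) :=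
  ⟨_, ⟨_, inferInstance, _, rfl⟩, rfl⟩

/-- The automaton yields some word of the language with the right numerator and denominator; as
neither word has leading [0,0], it is `w` itself. Conversely `x` is the denominator track of `w`,
whose leading zeros are harmless. -/
theorem mem_fixedQuotient_iff {k : ℕ} (hk : 2 ≤ k) {c : AutCode}
    (hL : Admissible (c.pairLang k)) (a : ℕ) (w : List (Fin k × Fin k)) :
    w ∈ fixedQuotient k a (valueSet ((carryCode k c a 1 0).lang k)) ↔
      w ∈ c.pairLang k ∧ num w = a * den w := by
  constructor
  · rintro ⟨m, ⟨x, hx, rfl⟩, hw, hn, hd⟩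
    obtain ⟨w', hw', -, hn', hd'⟩ := (mem_carryCode_lang c a 1 0 x).1 hx
    obtain rfl : w = w' := eq_of_noLeadingZeroPair hk hw (hL.1 _ hw').1
      (by rw [hn, hn', mul_comm]) (by rw [hd, hd']; ring)
    exact ⟨hw', by rw [hn, hd, mul_comm]⟩
  · rintro ⟨hw, hn⟩
    exact ⟨den w, ⟨w.map Prod.snd, (mem_carryCode_lang c a 1 0 _).2
      ⟨w, hw, by simp, hn, by simp [den]⟩, rfl⟩, (hL.1 _ hw).1, by rw [hn, mul_comm], rfl⟩

theorem mem_fixedDenominator_iff {k : ℕ} (hk : 2 ≤ k) {c : AutCode}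
    (hL : Admissible (c.pairLang k)) (b : ℕ) (w : List (Fin k × Fin k)) :
    w ∈ fixedDenominator k b (valueSet ((carryCode k c b 0 b).lang k)) ↔
      w ∈ c.pairLang k ∧ den w = b := by
  constructor
  · rintro ⟨m, ⟨x, hx, rfl⟩, hw, hn, hd⟩
    obtain ⟨w', hw', -, hn', hd'⟩ := (mem_carryCode_lang c b 0 b x).1 hx
    obtain rfl : w = w' := eq_of_noLeadingZeroPair hk hw (hL.1 _ hw').1
      (by rw [hn, hn']) (by rw [hd, hd']; ring)
    exact ⟨hw', hd⟩
  · rintro ⟨hw, rfl⟩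
    obtain ⟨n, hn⟩ := hL.den_dvd_num hw
    -- The quotient is at most `num w`, so it can be written with exactly `w.length` digits, as the
    -- automaton demands.
    have hlt : n < k ^ w.length :=
      (Nat.le_mul_of_pos_left n (Nat.pos_of_ne_zero (hL.2.1 w hw))).trans_lt
        (hn ▸ num_lt hk w)
    obtain ⟨x, hx, rfl⟩ := exists_value_eq n w.length hlt
    exact ⟨value x, ⟨x, (mem_carryCode_lang c _ 0 _ _).2 ⟨w, hw, hx.symm, hn, by simp⟩, rfl⟩,
      (hL.1 _ hw).1, hn, rfl⟩

theorem decomp_describes {k : ℕ} (hk : 2 ≤ k) {c : AutCode} (hL : Admissible (c.pairLang k)) :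
    (decomp k c).Describes (c.pairLang k) := by
  refine ⟨fun i => isNatAutomatic_lang k _, fun j => isNatAutomatic_lang k _, ?_⟩
  have h1 : ∀ a, a < k ^ (c.1 + 1) + 1 → ∃ i : Fin (decomp k c).1.length,
      (decomp k c).1.get i = (a, carryCode k c a 1 0) := fun a ha =>
    ⟨⟨a, by simpa [decomp] using ha⟩, by simp [decomp]⟩
  have h2 : ∀ b, b < k ^ (c.1 + 1) → ∃ j : Fin (decomp k c).2.length,
      (decomp k c).2.get j = (b, carryCode k c b 0 b) := fun b hb =>
    ⟨⟨b, by simpa [decomp] using hb⟩, by simp [decomp]⟩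
  have h3 : ∀ i, (decomp k c).1.get i =
      (((decomp k c).1.get i).1, carryCode k c ((decomp k c).1.get i).1 1 0) := by
    simp [decomp]
  have h4 : ∀ j, (decomp k c).2.get j =
      (((decomp k c).2.get j).1, carryCode k c ((decomp k c).2.get j).1 0
        ((decomp k c).2.get j).1) := by
    simp [decomp]
  ext w
  simp only [Set.mem_ofPred_eq, Set.mem_union, Set.mem_iUnion]
  constructor
  · intro hw
    rcases Admissible.num_le_or_den_lt hk _ hL hw with h | h
    · left
      rw [Fintype.card_fin] at h
      obtain ⟨a, ha⟩ := hL.den_dvd_num hw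
      have hlt : a < k ^ (c.1 + 1) + 1 := by
        rw [ha, mul_comm] at h
        exact Nat.lt_succ_of_le (Nat.le_of_mul_le_mul_right h (Nat.pos_of_ne_zero (hL.2.1 w hw)))
      obtain ⟨i, hi⟩ := h1 a hlt
      refine ⟨i, ?_⟩
      rw [hi, mem_fixedQuotient_iff hk hL]
      exact ⟨hw, by rw [ha, mul_comm]⟩
    · right
      rw [Fintype.card_fin] at h
      obtain ⟨j, hj⟩ := h2 _ h
      refine ⟨j, ?_⟩
      rw [hj, mem_fixedDenominator_iff hk hL]
      exact ⟨hw, rfl⟩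
  · rintro (⟨i, hi⟩ | ⟨j, hj⟩)
    · rw [h3, mem_fixedQuotient_iff hk hL] at hi
      exact hi.1
    · rw [h4, mem_fixedDenominator_iff hk hL] at hj
      exact hj.1

/-- Every regular language over `Σ_k²` is described by a transition table. -/
theorem exists_pairLang_eq {k : ℕ} {L : Language (Fin k × Fin k)} (hL : L.IsRegular) :
    ∃ c : AutCode, c.pairLang k = L := by
  obtain ⟨σ, _, M, rfl⟩ := hL
  classical
  obtain ⟨n, hn⟩ : ∃ n, Fintype.card σ = n + 1 :=
    Nat.exists_eq_succ_of_ne_zero (Fintype.card_pos_iff.2 ⟨M.start⟩).ne'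
  let g₀ : σ ≃ Fin (n + 1) := Fintype.equivFinOfCardEq hn
  -- The swap moves the start state to `0`, where every `AutCode` starts.
  let g : σ ≃ Fin (n + 1) := g₀.trans (Equiv.swap (g₀ M.start) 0)
  have hg : g M.start = 0 := by simp [g]
  let N := DFA.reindex g M
  let t : List ℕ := List.ofFn fun i : Fin ((n + 1) * (k * k)) =>
    (N.step (finProdFinEquiv.symm i).1 (finProdFinEquiv.symm (finProdFinEquiv.symm i).2)).val
  let F : List ℕ := (List.finRange (n + 1)).filter (· ∈ N.accept) |>.map Fin.val
  refine ⟨(n, t, F), ?_⟩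
  let D : DFA (Fin k × Fin k) (Fin (n + 1)) := AutCode.toDFA finProdFinEquiv (n, t, F)
  have hN : D = N := by
    have hstep : D.step = N.step := by
      funext q p
      have hidx : q.val * (k * k) + (finProdFinEquiv p).val =
          (finProdFinEquiv ((q : Fin (n + 1)), finProdFinEquiv p)).val := by
        rw [finProdFinEquiv_apply_val (q, finProdFinEquiv p)]
        ring
      have ht : ∀ i : Fin ((n + 1) * (k * k)), t.getD i.val 0 = (N.step (finProdFinEquiv.symm i).1
          (finProdFinEquiv.symm (finProdFinEquiv.symm i).2)).val := fun i => by
        rw [List.getD_eq_getElem _ _ (by simp [t])]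
        simp [t]
      apply Fin.ext
      change t.getD _ 0 % (n + 1) = _
      rw [hidx, ht, Nat.mod_eq_of_lt (Fin.isLt _), Equiv.symm_apply_apply,
        Equiv.symm_apply_apply]
    have hacc : D.accept = N.accept := by
      ext q
      change q.val ∈ F ↔ _
      simp [F, Fin.val_inj]
    have hstart : D.start = N.start := hg.symm
    cases h : N
    rw [h] at hstep hacc hstart
    cases h' : D
    rw [h'] at hstep hacc hstart
    subst hstep hacc hstart
    rfl
  change D.accepts = _
  rw [hN]
  exact DFA.accepts_reindex M g

end Decomposition

end AutomaticRationals

theorem mainTheorem9 :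
    (∀ k : ℕ, 2 ≤ k → ∀ L : Language (Fin k × Fin k), L.IsRegular →
      AutomaticRationals.Admissible L →
        ∃ (A B : ℕ) (a : Fin A → ℕ) (S : Fin A → Set ℕ) (b : Fin B → ℕ) (T : Fin B → Set ℕ),
          AutomaticRationals.IsDecomposition L a S b T) ∧
    (∃ f : ℕ × AutomaticRationals.AutCode →. AutomaticRationals.DecompCode, Partrec f ∧
      ∀ k : ℕ, 2 ≤ k → ∀ c : AutomaticRationals.AutCode,
        AutomaticRationals.Admissible (AutomaticRationals.AutCode.pairLang k c) →
          ∃ d ∈ f (k, c), d.Describes (AutomaticRationals.AutCode.pairLang k c)) := by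
  constructor
  · intro k hk L hreg hL
    obtain ⟨c, rfl⟩ := AutomaticRationals.exists_pairLang_eq hreg
    exact ⟨_, _, _, _, _, _, AutomaticRationals.decomp_describes hk hL⟩
  -- `decomp` is total; admissibility matters only for its correctness.
  · refine ⟨fun z => Part.some (AutomaticRationals.decomp z.1 z.2),
      AutomaticRationals.primrec_decomp.to_comp, fun k hk c hL => ?_⟩
    exact ⟨_, Part.mem_some _, AutomaticRationals.decomp_describes hk hL⟩
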